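/- Let $n\ge 2$ and $L\ge 0$, let $P$ be the permutation matrix on $\mathbb C^n\otimes\mathbb C^n$ and $R(u)=\frac{u+iP}{u+i}$. Boundary data are triples $b=(l,\xi_-,\xi_+)$ with $l\in\{1,\dots,n-1\}$ and $\xi_\mp\in\mathbb C$. Put $$K^-_{(l)}(u,\xi_-)=\mathrm{diag}(\underbrace{i\xi_--u,\dots}_{l},\underbrace{i\xi_-+u,\dots}_{n-l}),\qquad K^+_{(l)}(u,\xi_+)=\mathrm{diag}(\underbrace{i\xi_++u,\dots}_{l},\underbrace{i(\xi_+-n)-u,\dots}_{n-l}),$$ and on $(\mathbb C^n)^{\otimes L}$ let $T_0(u)=R_{0L}(u)\cdots R_{01}(u)$, $\hat T_0(u)=R_{10}(u)\cdots R_{L0}(u)$ and $$t_{(l)}(u,\xi_\mp)=\mathrm{tr}_0\,K^+_{(l)\,0}(u,\xi_+)\,T_0(u)\,K^-_{(l)\,0}(u,\xi_-)\,\hat T_0(u).$$ **Bethe Ansatz equations.** An implementation of the algebraic Bethe Ansatz for an operator function $t(u)$ on $(\mathbb C^n)^{\otimes L}$ with a pseudovacuum $\Omega\neq0$ consists of $m\in\{1,\dots,n-1\}$,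 $\zeta\in\mathbb C$, and an $n\times n$ matrix $\mathcal T(u)$ of operators on $(\mathbb C^n)^{\otimes L}$, meromorphic in $u$, such that $$R_{12}(u-v)\,\mathcal T_1(u)\,R_{21}(u+v)\,\mathcal T_2(v)=\mathcal T_2(v)\,R_{12}(u+v)\,\mathcal T_1(u)\,R_{21}(u-v),\qquad t(u)=\mathrm{tr}_0\,K^+_{(m)\,0}(u,\zeta)\,\mathcal T_0(u),$$ $\mathcal T_{jk}(u)\Omega=0$ for $j>k$, and $\mathcal T_{jj}(u)\Omega=\delta_j(u)\Omega$. Let $\kappa_1,\dots,\kappa_n$ be the diagonal entries of $K^+_{(m)}(u,\zeta)$. For Bethe roots $\{\lambda^{(k)}_\alpha\}$ ($1\le k\le n-1$, $1\le\alpha\le M^{(k)}$) put $Q_k(x)=\prod_\alpha(x-\lambda^{(k)}_\alpha)(x+\lambda^{(k)}_\alpha)$ and $Q_0=Q_n=1$. The transfer-matrix eigenvalue given by the nested Bethe Ansatz is $$\Lambda(u)=\sum_{k=1}^n\Big(\kappa_k+\tfrac{i}{2u+ki}\sum_{p>k}\kappa_p\Big)\Big(\delta_k-\tfrac{i}{2u+(k-1)i}\sum_{p<k}\delta_p\Big)\frac{Q_{k-1}(u+\frac{(k+1)i}2)}{Q_{k-1}(u+\frac{(k-1)i}2)}\,\frac{Q_k(u+\frac{(k-2)i}2)}{Q_k(u+\frac{ki}2)}.$$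 The Bethe Ansatz equations (BAE) of the implementation are the conditions on the roots that $\Lambda$ has zero residue at $u=\lambda^{(k)}_\alpha-\frac{ki}2$ for all $k,\alpha$. A system of equations for the roots (for all choices of the numbers $M^{(k)}$) is called a system of BAE for $t$ with pseudovacuum $\Omega$ if it has the same solutions as the BAE of some implementation for $(t,\Omega)$. With $\omega_{(1)}=e_1^{\otimes L}$, the matrix $\mathcal T=T K^-_{(l)}\hat T$ together with $K^+_{(l)}(u,\xi_+)$ is an implementation for $(t_{(l)}(\cdot,\xi_\mp),\omega_{(1)})$, called the standard one. **Lemma.** Let $D$ be a set of boundary data and $g:D\to D$, $(l,\xi_\mp)\mapsto(l',\xi'_\mp)$, a map with $g^2=1$. For each $b=(l,\xi_\mp)\in D$ let $\mathcal U_b$ be a unitary operator on $(\mathbb C^n)^{\otimes L}$, and let $\omega,\omega'$ be vectors, such that for all $b\in D$ $$\mathcal U_b\,t_{(l)}(u,\xi_\mp)\,\mathcal U_b^\dagger=t_{(l')}(u,\xi'_\mp)\ \text{ for all } u,\qquad \mathcal U_b\,\omega=\omega'.$$ Then for every $(l,\xi_\mp)\in D$ the BAE for $t_{(l)}(u,\xi_\mp)$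 with the pseudovacuum $\omega'$ are the same as the BAE for $t_{(l')}(u,\xi'_\mp)$ with the pseudovacuum $\omega$: a system of equations is a system of BAE for the former if and only if it is one for the latter. In particular, if $\omega=\omega_{(1)}$, then the standard BAE for $(l',\xi'_\mp)$ are BAE for $t_{(l)}(u,\xi_\mp)$ with the pseudovacuum $\omega'$. -/

import Mathlib

open Matrix Filter Topology

namespace OpenChain

/-! ### The quantum space, the `R` matrix and the transfer matrix

`n` is the dimension of the one-site space `ℂⁿ` and `L` is the number of sites. The quantum space
`(ℂⁿ)^{⊗L}` is described in its standard product basis, indexed by `Fin L → Fin n`; basis labels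
`1, …, n` are shifted to `0, …, n-1`. -/

/-- Vectors of the quantum space. -/
abbrev State (n L : ℕ) := (Fin L → Fin n) → ℂ

/-- Operators on the quantum space. -/
abbrev Op (n L : ℕ) := Matrix (Fin L → Fin n) (Fin L → Fin n) ℂ

/-- Matrices in the auxiliary space whose entries are operators on the quantum space. -/
abbrev AuxOp (n L : ℕ) := Matrix (Fin n) (Fin n) (Op n L)

/-- The boundary data `(l, ξ₋, ξ₊)`, with `l ∈ {1, …, n-1}`. -/
@[ext]
structure BoundaryData (n : ℕ) where
  l : ℕ
  one_le : 1 ≤ l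
  lt : l < n
  xiMinus : ℂ
  xiPlus : ℂ

/-- The permutation matrix `x ⊗ y ↦ y ⊗ x`. -/
def permMatrix (n : ℕ) : Matrix (Fin n × Fin n) (Fin n × Fin n) ℂ :=
  Matrix.of fun p q => if p.1 = q.2 ∧ p.2 = q.1 then 1 else 0

/-- `R(u) = (u + i P) / (u + i)`. -/
noncomputable def rMatrix (n : ℕ) (u : ℂ) : Matrix (Fin n × Fin n) (Fin n × Fin n) ℂ :=
  (u + Complex.I)⁻¹ • (u • 1 + Complex.I • permMatrix n)

/-- The tensor product `F₁ ⊗ ⋯ ⊗ F_L`. -/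
def tensorOp {n L : ℕ} (F : Fin L → Matrix (Fin n) (Fin n) ℂ) : Op n L :=
  Matrix.of fun x y => ∏ j, F j (x j) (y j)

/-- `1 ⊗ ⋯ ⊗ A ⊗ ⋯ ⊗ 1`, with `A` at site `k`. -/
def siteOp {n L : ℕ} (k : Fin L) (A : Matrix (Fin n) (Fin n) ℂ) : Op n L :=
  tensorOp (Function.update 1 k A)

/-- `R_{0k}(u)` as a matrix in the auxiliary space `0`. -/
noncomputable def rAux {n L : ℕ} (k : Fin L) (u : ℂ) : AuxOp n L :=
  Matrix.of fun a b => siteOp k (Matrix.of fun c d => rMatrix n u (a, c) (b, d))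

/-- `R_{k0}(u)` as a matrix in the auxiliary space `0`. -/
noncomputable def rAux' {n L : ℕ} (k : Fin L) (u : ℂ) : AuxOp n L :=
  Matrix.of fun a b => siteOp k (Matrix.of fun c d => rMatrix n u (c, a) (d, b))

/-- `T₀(u) = R_{0L}(u) ⋯ R_{01}(u)`. -/
noncomputable def monodromy (n L : ℕ) (u : ℂ) : AuxOp n L :=
  (List.ofFn fun k : Fin L => rAux k u).reverse.prod

/-- `T̂₀(u) = R_{10}(u) ⋯ R_{L0}(u)`. -/
noncomputable def monodromyHat (n L : ℕ) (u : ℂ) : AuxOp n L :=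
  (List.ofFn fun k : Fin L => rAux' k u).prod

/-- Diagonal entries of `K⁻_{(l)}(u, ξ)`: `iξ - u` (`l` times), then `iξ + u`. -/
noncomputable def kMinus {n : ℕ} (l : ℕ) (xi : ℂ) (j : Fin n) (u : ℂ) : ℂ :=
  if (j : ℕ) < l then Complex.I * xi - u else Complex.I * xi + u

/-- Diagonal entries of `K⁺_{(l)}(u, ξ)`: `iξ + u` (`l` times), then `i(ξ - n) - u`. -/
noncomputable def kPlus {n : ℕ} (l : ℕ) (xi : ℂ) (j : Fin n) (u : ℂ) : ℂ :=
  if (j : ℕ) < l then Complex.I * xi + u else Complex.I * (xi - n) - u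

/-- A diagonal matrix acting in the auxiliary space only. -/
def auxDiag {n : ℕ} (L : ℕ) (d : Fin n → ℂ) : AuxOp n L :=
  Matrix.diagonal fun j => d j • (1 : Op n L)

/-- The double-row monodromy matrix `T₀(u) K⁻(u) T̂₀(u)`. -/
noncomputable def doubleRow {n : ℕ} (L : ℕ) (b : BoundaryData n) (u : ℂ) : AuxOp n L :=
  monodromy n L u * auxDiag L (fun j => kMinus b.l b.xiMinus j u) * monodromyHat n L u

/-- The transfer matrix `t_{(l)}(u, ξ∓) = tr₀ K⁺₀(u) T₀(u) K⁻₀(u) T̂₀(u)`. -/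
noncomputable def transfer {n : ℕ} (L : ℕ) (b : BoundaryData n) (u : ℂ) : Op n L :=
  Matrix.trace (auxDiag L (fun j => kPlus b.l b.xiPlus j u) * doubleRow L b u)

/-- The pseudovacuum `ω_(k) = e_k ⊗ ⋯ ⊗ e_k`, with `k` counted from `1`. -/
def pseudovacuum (n L : ℕ) (k : ℕ) : State n L :=
  fun x => if ∀ i, (x i : ℕ) + 1 = k then 1 else 0

/-! ### The nested algebraic Bethe Ansatz -/

/-- `A ⊗ 1` on two copies of the auxiliary space. -/
def leg1 {n L : ℕ} (A : AuxOp n L) : Matrix (Fin n × Fin n) (Fin n × Fin n) (Op n L) :=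
  Matrix.of fun p q => if p.2 = q.2 then A p.1 q.1 else 0

/-- `1 ⊗ A` on two copies of the auxiliary space. -/
def leg2 {n L : ℕ} (A : AuxOp n L) : Matrix (Fin n × Fin n) (Fin n × Fin n) (Op n L) :=
  Matrix.of fun p q => if p.1 = q.1 then A p.2 q.2 else 0

/-- `R₁₂(u)` on two copies of the auxiliary space (it equals `R₂₁(u)`). -/
noncomputable def rTwo (n L : ℕ) (u : ℂ) : Matrix (Fin n × Fin n) (Fin n × Fin n) (Op n L) :=
  (rMatrix n u).map fun c => c • (1 : Op n L)

/-- An implementation of the algebraic Bethe Ansatz for the transfer matrix `t` on the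
pseudovacuum `Ω`: an operator-valued matrix obeying the boundary Yang-Baxter equation (the
reflection algebra), from which `t` is obtained by tracing with one of the matrices `K⁺`, and
for which `Ω` is a highest-weight vector. The entries of the matrix above the diagonal are the
creation operators, those below it annihilate `Ω`, the diagonal ones have `Ω` as eigenvector. -/
structure BetheAnsatz {n L : ℕ} (t : ℂ → Op n L) (Ω : State n L) where
  /-- The parameters of `K⁺`. -/
  l : ℕ
  one_le : 1 ≤ l
  lt : l < n
  xiPlus : ℂ
  /-- The double-row monodromy matrix. -/
  mono : ℂ → AuxOp n L
  meromorphic : ∀ j k x y, Meromorphic fun u => mono u j k x y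
  reflection : ∀ u v : ℂ,
    rTwo n L (u - v) * leg1 (mono u) * rTwo n L (u + v) * leg2 (mono v) =
      leg2 (mono v) * rTwo n L (u + v) * leg1 (mono u) * rTwo n L (u - v)
  trace_eq : ∀ u, t u = Matrix.trace (auxDiag L (fun j => kPlus l xiPlus j u) * mono u)
  /-- The vacuum eigenvalues. -/
  vac : Fin n → ℂ → ℂ
  vacuum_ne : Ω ≠ 0
  vacuum_lower : ∀ u j k, k < j → mono u j k *ᵥ Ω = 0
  vacuum_diag : ∀ u j, mono u j j *ᵥ Ω = vac j u • Ω

/-- Bethe roots: `M^{(k)}` numbers `λ^{(k)}_α` at each level `k = 1, …, n-1`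
(level `k` has index `k - 1`). -/
abbrev Roots (n : ℕ) (M : Fin (n - 1) → ℕ) := (k : Fin (n - 1)) → Fin (M k) → ℂ

/-- `Q_m(x) = ∏_α (x - λ^{(m)}_α)(x + λ^{(m)}_α)` for the levels `1 ≤ m ≤ n-1`;
`Q_0 = Q_n = 1`. -/
noncomputable def Q {n : ℕ} {M : Fin (n - 1) → ℕ} (v : Roots n M) (m : ℕ) (x : ℂ) : ℂ :=
  if h : 0 < m ∧ m - 1 < n - 1 then
    ∏ α, (x - v ⟨m - 1, h.2⟩ α) * (x + v ⟨m - 1, h.2⟩ α)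
  else 1

/-- The transfer-matrix eigenvalue produced by the nested algebraic Bethe Ansatz: with vacuum
eigenvalues `δ_1, …, δ_n` and diagonal entries `κ_1, …, κ_n` of `K⁺`, it is the sum over
`k = 1, …, n` of
`(κ_k + i/(2u+ki) ∑_{p>k} κ_p) (δ_k - i/(2u+(k-1)i) ∑_{p<k} δ_p)
  Q_{k-1}(u+(k+1)i/2)/Q_{k-1}(u+(k-1)i/2) Q_k(u+(k-2)i/2)/Q_k(u+ki/2)`.
Below `j = k - 1`. -/
noncomputable def betheEigenvalue {n : ℕ} (κ δ : Fin n → ℂ → ℂ) {M : Fin (n - 1) → ℕ}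
    (v : Roots n M) (u : ℂ) : ℂ :=
  ∑ j : Fin n,
    (κ j u + Complex.I / (2 * u + ((j : ℕ) + 1) * Complex.I) * ∑ p ∈ Finset.Ioi j, κ p u) *
    (δ j u - Complex.I / (2 * u + (j : ℕ) * Complex.I) * ∑ p ∈ Finset.Iio j, δ p u) *
    (Q v j (u + (j : ℕ) * Complex.I / 2 + Complex.I) / Q v j (u + (j : ℕ) * Complex.I / 2)) *
    (Q v (j + 1) (u + ((j : ℕ) + 1) * Complex.I / 2 - Complex.I) /
      Q v (j + 1) (u + ((j : ℕ) + 1) * Complex.I / 2))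

/-- `f` has residue `c` at `p`: `(2πi)⁻¹ ∮ f = c` over all small circles around `p`. -/
def HasResidueAt (f : ℂ → ℂ) (p c : ℂ) : Prop :=
  ∀ᶠ r in 𝓝[>] (0 : ℝ), (2 * Real.pi * Complex.I)⁻¹ * (∮ z in C(p, r), f z) = c

/-- The eigenvalue, as a function of the Bethe roots and the spectral parameter. -/
noncomputable def BetheAnsatz.eigenvalue {n L : ℕ} {t : ℂ → Op n L} {Ω : State n L}
    (A : BetheAnsatz t Ω) {M : Fin (n - 1) → ℕ} (v : Roots n M) (u : ℂ) : ℂ :=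
  betheEigenvalue (kPlus A.l A.xiPlus) A.vac v u

/-- The Bethe Ansatz equations of an implementation, for root numbers `M`: for every root
`λ^{(k)}_α` the residue of the eigenvalue at `u = λ^{(k)}_α - ki/2` vanishes. -/
def BetheAnsatz.SolvesBAE {n L : ℕ} {t : ℂ → Op n L} {Ω : State n L}
    (A : BetheAnsatz t Ω) {M : Fin (n - 1) → ℕ} (v : Roots n M) : Prop :=
  ∀ (k : Fin (n - 1)) (α : Fin (M k)),
    HasResidueAt (A.eigenvalue v) (v k α - ((k : ℕ) + 1) * Complex.I / 2) 0

/-- `E` is a system of Bethe Ansatz equations (one for each choice of the root numbers) for the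
transfer matrix `t` with the pseudovacuum `Ω`. -/
def IsBAE {n L : ℕ} (t : ℂ → Op n L) (Ω : State n L)
    (E : (M : Fin (n - 1) → ℕ) → Roots n M → Prop) : Prop :=
  ∃ A : BetheAnsatz t Ω, ∀ M v, E M v ↔ A.SolvesBAE v

/-! ### The double-row monodromy matrix implements the Bethe Ansatz on `ω_(1)` -/

section proofs
variable {n L : ℕ}

theorem tensorOp_mul (F G : Fin L → Matrix (Fin n) (Fin n) ℂ) :
    tensorOp F * tensorOp G = tensorOp (fun j => F j * G j) := by
  ext x y
  simp only [tensorOp, Matrix.mul_apply, Matrix.of_apply, ← Finset.prod_mul_distrib]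
  rw [Finset.prod_univ_sum]
  simp

theorem siteOp_apply (k : Fin L) (A : Matrix (Fin n) (Fin n) ℂ) (x y) :
    siteOp k A x y = A (x k) (y k) *
      ∏ j ∈ Finset.univ.erase k, (1 : Matrix (Fin n) (Fin n) ℂ) (x j) (y j) := by
  simp only [siteOp, tensorOp, Matrix.of_apply]
  rw [← Finset.mul_prod_erase _ _ (Finset.mem_univ k)]
  congr 1
  · simp
  · refine Finset.prod_congr rfl fun j hj => ?_
    rw [Function.update_of_ne (Finset.ne_of_mem_erase hj)]; rfl

theorem siteOp_add (k : Fin L) (A B : Matrix (Fin n) (Fin n) ℂ) :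
    siteOp k (A + B) = siteOp k A + siteOp k B := by
  ext x y; simp [siteOp_apply, add_mul]

theorem siteOp_smul (k : Fin L) (c : ℂ) (A : Matrix (Fin n) (Fin n) ℂ) :
    siteOp k (c • A) = c • siteOp k A := by
  ext x y; simp [siteOp_apply, mul_assoc]

theorem siteOp_zero (k : Fin L) : siteOp k (0 : Matrix (Fin n) (Fin n) ℂ) = 0 := by
  ext x y; simp [siteOp_apply]

theorem siteOp_one (k : Fin L) : siteOp k (1 : Matrix (Fin n) (Fin n) ℂ) = 1 := by
  ext x y
  have : Function.update (1 : Fin L → Matrix (Fin n) (Fin n) ℂ) k 1 = 1 :=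
    Function.update_eq_self k _
  simp only [siteOp, this, tensorOp, Matrix.of_apply, Pi.one_apply, Matrix.one_apply]
  rw [Finset.prod_ite_zero]
  simp [funext_iff]

theorem siteOp_mul (k : Fin L) (A B : Matrix (Fin n) (Fin n) ℂ) :
    siteOp k A * siteOp k B = siteOp k (A * B) := by
  rw [siteOp, siteOp, tensorOp_mul, siteOp]
  congr 1; funext j
  by_cases h : j = k
  · subst h; simp
  · simp [Function.update_of_ne h]

theorem siteOp_comm {k k' : Fin L} (h : k ≠ k') (A B : Matrix (Fin n) (Fin n) ℂ) :
    Commute (siteOp k A) (siteOp k' B) := by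
  unfold Commute SemiconjBy
  rw [siteOp, siteOp, tensorOp_mul, tensorOp_mul]
  congr 1; funext j
  by_cases h1 : j = k
  · subst h1; simp [Function.update_of_ne h]
  · simp [Function.update_of_ne h1]

/-- The site permutation `P_{0k}` as a matrix in the auxiliary space. -/
def permAux (k : Fin L) : AuxOp n L :=
  Matrix.of fun a b => siteOp k (Matrix.single b a 1)

theorem rAux_eq (k : Fin L) (u : ℂ) : (rAux k u : AuxOp n L) =
    (u + Complex.I)⁻¹ • (u • 1 + Complex.I • permAux k) := by
  refine Matrix.ext fun a b => ?_
  have : (Matrix.of fun c d => rMatrix n u (a, c) (b, d)) =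
      (u + Complex.I)⁻¹ • (u • (if a = b then (1 : Matrix (Fin n) (Fin n) ℂ) else 0)
        + Complex.I • Matrix.single b a 1) := by
    ext c d
    by_cases h : a = b <;>
    simp [rMatrix, permMatrix, Matrix.one_apply, Matrix.single_apply, h, eq_comm, and_comm]
  simp only [rAux, Matrix.of_apply, this, siteOp_smul, siteOp_add, permAux, Matrix.smul_apply,
    Matrix.add_apply]
  by_cases h : a = b
  · subst h; simp [siteOp_one]
  · simp [h, siteOp_zero]

theorem rAux'_eq (k : Fin L) (u : ℂ) : (rAux' k u : AuxOp n L) = rAux k u := by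
  refine Matrix.ext fun a b => ?_
  simp only [rAux, rAux', Matrix.of_apply]
  congr 1; ext c d
  simp [rMatrix, permMatrix, Matrix.one_apply, and_comm]

theorem permAux_mul (k : Fin L) (a b c d : Fin n) :
    (permAux k : AuxOp n L) a b * permAux k c d = if a = d then permAux k c b else 0 := by
  simp only [permAux, Matrix.of_apply, siteOp_mul]
  by_cases h : a = d
  · subst h; simp
  · simp [h, siteOp_zero, Matrix.single_mul_single_of_ne _ _ _ _ h]

/-- `P₁₂` on two copies of the auxiliary space. -/
def permTwo (n L : ℕ) : Matrix (Fin n × Fin n) (Fin n × Fin n) (Op n L) :=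
  Matrix.of fun p q => if p.1 = q.2 ∧ p.2 = q.1 then 1 else 0

theorem rTwo_eq (u : ℂ) : rTwo n L u =
    (u + Complex.I)⁻¹ • (u • 1 + Complex.I • permTwo n L) := by
  refine Matrix.ext fun p q => ?_
  simp only [rTwo, rMatrix, permMatrix, permTwo, Matrix.map_apply, Matrix.smul_apply,
    Matrix.add_apply, Matrix.of_apply, Matrix.one_apply, smul_eq_mul]
  split_ifs <;> module

theorem permTwo_mul (X : Matrix (Fin n × Fin n) (Fin n × Fin n) (Op n L)) (p q) :
    (permTwo n L * X) p q = X p.swap q := by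
  rw [Matrix.mul_apply, Finset.sum_eq_single p.swap]
  · simp [permTwo]
  · intro r _ hr
    have : ¬ (p.1 = r.2 ∧ p.2 = r.1) := fun h => hr (Prod.ext h.2.symm h.1.symm)
    simp [permTwo, this]
  · simp

theorem mul_permTwo (X : Matrix (Fin n × Fin n) (Fin n × Fin n) (Op n L)) (p q) :
    (X * permTwo n L) p q = X p q.swap := by
  rw [Matrix.mul_apply, Finset.sum_eq_single q.swap]
  · simp [permTwo]
  · intro r _ hr
    have : ¬ (r.1 = q.2 ∧ r.2 = q.1) := fun h => hr (Prod.ext h.1 h.2)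
    simp [permTwo, this]
  · simp

theorem permTwo_sq : permTwo n L * permTwo n L = 1 := by
  refine Matrix.ext fun p q => ?_
  rw [permTwo_mul]
  simp [permTwo, Matrix.one_apply, Prod.ext_iff, and_comm]

theorem permTwo_leg1 (A : AuxOp n L) : permTwo n L * leg1 A = leg2 A * permTwo n L := by
  refine Matrix.ext fun p q => ?_
  rw [permTwo_mul, mul_permTwo]; simp [leg1, leg2]

theorem permTwo_leg2 (A : AuxOp n L) : permTwo n L * leg2 A = leg1 A * permTwo n L := by
  refine Matrix.ext fun p q => ?_
  rw [permTwo_mul, mul_permTwo]; simp [leg1, leg2]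

theorem leg1_mul_apply (A : AuxOp n L) (X : Matrix (Fin n × Fin n) (Fin n × Fin n) (Op n L))
    (p q) : (leg1 A * X) p q = ∑ a, A p.1 a * X (a, p.2) q := by
  rw [Matrix.mul_apply, Fintype.sum_prod_type]
  simp [leg1]

theorem leg2_mul_apply (A : AuxOp n L) (X : Matrix (Fin n × Fin n) (Fin n × Fin n) (Op n L))
    (p q) : (leg2 A * X) p q = ∑ a, A p.2 a * X (p.1, a) q := by
  rw [Matrix.mul_apply, Fintype.sum_prod_type]
  simp [leg2]

theorem leg1_mul (A B : AuxOp n L) : leg1 (A * B) = leg1 A * leg1 B := by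
  refine Matrix.ext fun p q => ?_
  rw [leg1_mul_apply]
  by_cases h : p.2 = q.2 <;> simp [leg1, Matrix.mul_apply, h]

theorem leg2_mul (A B : AuxOp n L) : leg2 (A * B) = leg2 A * leg2 B := by
  refine Matrix.ext fun p q => ?_
  rw [leg2_mul_apply]
  by_cases h : p.1 = q.1 <;> simp [leg2, Matrix.mul_apply, h]

theorem leg1_leg2_apply (A B : AuxOp n L) (p q) :
    (leg1 A * leg2 B) p q = A p.1 q.1 * B p.2 q.2 := by
  rw [leg1_mul_apply]; simp [leg2]

theorem leg2_leg1_apply (A B : AuxOp n L) (p q) :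
    (leg2 A * leg1 B) p q = A p.2 q.2 * B p.1 q.1 := by
  rw [leg2_mul_apply]; simp [leg1]

theorem leg_comm {A B : AuxOp n L} (h : ∀ a b c d, Commute (A a b) (B c d)) :
    leg1 A * leg2 B = leg2 B * leg1 A := by
  refine Matrix.ext fun p q => ?_
  rw [leg1_leg2_apply, leg2_leg1_apply]; exact h _ _ _ _

theorem leg1_lin (c u w : ℂ) (A : AuxOp n L) :
    leg1 (c • (u • 1 + w • A)) = c • (u • 1 + w • leg1 A) := by
  refine Matrix.ext fun p q => ?_
  by_cases h : p.2 = q.2 <;> by_cases h' : p.1 = q.1 <;>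
    simp [leg1, Matrix.one_apply, h, h', Prod.ext_iff]

theorem leg2_lin (c u w : ℂ) (A : AuxOp n L) :
    leg2 (c • (u • 1 + w • A)) = c • (u • 1 + w • leg2 A) := by
  refine Matrix.ext fun p q => ?_
  by_cases h : p.2 = q.2 <;> by_cases h' : p.1 = q.1 <;>
    simp [leg2, Matrix.one_apply, h, h', Prod.ext_iff]

theorem perm_rel1 (k : Fin L) : leg1 (permAux k : AuxOp n L) * leg2 (permAux k) =
    permTwo n L * leg1 (permAux k) := by
  refine Matrix.ext fun p q => ?_
  rw [leg1_leg2_apply, permTwo_mul, permAux_mul]; simp [leg1]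

theorem perm_rel2 (k : Fin L) : leg2 (permAux k : AuxOp n L) * leg1 (permAux k) =
    permTwo n L * leg2 (permAux k) := by
  refine Matrix.ext fun p q => ?_
  rw [leg2_leg1_apply, permTwo_mul, permAux_mul]; simp [leg2]

/-- The boundary Yang-Baxter equation. -/
def Reflection (X : ℂ → AuxOp n L) : Prop := ∀ u v : ℂ,
    rTwo n L (u - v) * leg1 (X u) * rTwo n L (u + v) * leg2 (X v) =
      leg2 (X v) * rTwo n L (u + v) * leg1 (X u) * rTwo n L (u - v)

theorem alg_smul3 {S : Type*} [Ring S] [Algebra ℂ S] (a b c : ℂ) (X Y Z : S) :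
    (a • X) * (b • Y) * (c • Z) = (a * b * c) • (X * Y * Z) := by
  simp only [smul_mul_assoc, mul_smul_comm, smul_smul]
  congr 1; ring

theorem alg_yb1 {S : Type*} [Ring S] [Algebra ℂ S] {E1 E2 P : S} (h1 : E1 * E2 = P * E1)
    (h2 : E2 * E1 = P * E2) (h3 : P * E1 = E2 * P) (h4 : P * E2 = E1 * P) (h5 : P * P = 1)
    (u v w : ℂ) :
    ((u - v) • 1 + w • P) * (u • 1 + w • E1) * (v • 1 + w • E2) =
      (v • 1 + w • E2) * (u • 1 + w • E1) * ((u - v) • 1 + w • P) := by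
  have h6 : P * E1 * E2 = E1 := by rw [mul_assoc, h1, ← mul_assoc, h5, one_mul]
  have h7 : E2 * E1 * P = E1 := by rw [h2, mul_assoc, ← h3, ← mul_assoc, h5, one_mul]
  simp only [mul_add, add_mul, smul_mul_assoc, mul_smul_comm, one_mul, mul_one, h6, h7]
  rw [h1, h2, ← h3, ← h4]
  module

theorem alg_yb2 {S : Type*} [Ring S] [Algebra ℂ S] {E1 E2 P : S} (h1 : E1 * E2 = P * E1)
    (h2 : E2 * E1 = P * E2) (h3 : P * E1 = E2 * P) (h4 : P * E2 = E1 * P)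
    (u v w : ℂ) :
    (u • 1 + w • E1) * ((u + v) • 1 + w • P) * (v • 1 + w • E2) =
      (v • 1 + w • E2) * ((u + v) • 1 + w • P) * (u • 1 + w • E1) := by
  have h8 : E1 * P * E2 = E2 * P * E1 := by
    have e1 : E1 * P * E2 = E2 * E1 * E2 := by rw [← h4, ← h2]
    have e2 : E2 * P * E1 = E2 * E1 * E2 := by rw [mul_assoc, ← h1, ← mul_assoc]
    rw [e1, e2]
  simp only [mul_add, add_mul, smul_mul_assoc, mul_smul_comm, one_mul, mul_one, h8]
  rw [h1, h2, ← h3, ← h4]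
  module

theorem alg_refl {S : Type*} [Ring S] [Algebra ℂ S] {P K K' J J' : S} {u v w : ℂ}
    (h3 : P * K = K' * P) (h4 : P * J' = J * P) (h5 : P * P = 1)
    (c1 : K * J' = J' * K) (c2 : K' * J' = J' * K')
    (hd : (u - v) • (K * J - J' * K') + (u + v) • (K' * J - J' * K) = 0) :
    ((u - v) • 1 + w • P) * K * ((u + v) • 1 + w • P) * J' =
      J' * ((u + v) • 1 + w • P) * K * ((u - v) • 1 + w • P) := by
  have a1 : K * P * J' = K * J * P := by rw [mul_assoc, h4, mul_assoc]
  have a2 : P * K * J' = K' * J * P := by rw [h3, mul_assoc, h4, mul_assoc]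
  have a3 : P * K * P * J' = J' * K' := by rw [h3, mul_assoc K', h5, mul_one, c2]
  have a4 : J' * P * K = J' * K' * P := by rw [mul_assoc, h3, mul_assoc]
  have a5 : J' * K' * P * P = J' * K' := by rw [mul_assoc, h5, mul_one]
  have hd' := congrArg (fun X => w • (X * P)) hd
  simp only [mul_add, add_mul, sub_mul, smul_mul_assoc, mul_smul_comm, one_mul, mul_one, zero_mul,
    smul_zero, a1, a2, a3, a4, a5, c1] at hd' ⊢
  rw [← sub_eq_zero] 
  refine Eq.trans ?_ hd'
  module

theorem alg_smul_refl {S : Type*} [Ring S] [Algebra ℂ S] {X Y K J : S} (a b : ℂ)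
    (h : X * K * Y * J = J * Y * K * X) :
    (a • X) * K * (b • Y) * J = J * (b • Y) * K * (a • X) := by
  simp only [smul_mul_assoc, mul_smul_comm, h, smul_smul]
  congr 1; ring

theorem yb1 (k : Fin L) (u v : ℂ) :
    rTwo n L (u - v) * leg1 (rAux k u) * leg2 (rAux k v) =
      leg2 (rAux k v) * leg1 (rAux k u) * rTwo n L (u - v) := by
  rw [rAux_eq, rAux_eq, leg1_lin, leg2_lin, rTwo_eq, alg_smul3, alg_smul3,
    alg_yb1 (perm_rel1 k) (perm_rel2 k) (permTwo_leg1 _) (permTwo_leg2 _) permTwo_sq]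
  congr 1; ring

theorem yb2 (k : Fin L) (u v : ℂ) :
    leg1 (rAux k u) * rTwo n L (u + v) * leg2 (rAux k v) =
      leg2 (rAux k v) * rTwo n L (u + v) * leg1 (rAux k u) := by
  rw [rAux_eq, rAux_eq, leg1_lin, leg2_lin, rTwo_eq, alg_smul3, alg_smul3,
    alg_yb2 (perm_rel1 k) (perm_rel2 k) (permTwo_leg1 _) (permTwo_leg2 _)]
  congr 1; ring

theorem Reflection.dress {X : ℂ → AuxOp n L} (hX : Reflection X) (k : Fin L)
    (hc : ∀ u v a b c d, Commute (X u a b) ((rAux k v : AuxOp n L) c d)) :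
    Reflection fun u => rAux k u * X u * rAux k u := by
  intro u v
  have c1 := leg_comm (hc u v)
  have c2 := leg_comm fun a b c d => (hc v u c d a b).symm
  have y1 := yb1 (n := n) k u v
  have y2 := yb2 (n := n) k u v
  have hX := hX u v
  simp only [leg1_mul, leg2_mul]
  generalize leg1 (rAux k u : AuxOp n L) = A at *
  generalize leg2 (rAux k v : AuxOp n L) = B at *
  generalize leg1 (X u) = Y at *
  generalize leg2 (X v) = Z at *
  generalize rTwo n L (u - v) = R at *
  generalize rTwo n L (u + v) = S at *
  calc R * (A * Y * A) * S * (B * Z * B) = R * A * Y * (A * S * B) * Z * B := by noncomm_ring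
    _ = R * A * (Y * B) * S * (A * Z) * B := by rw [y2]; noncomm_ring
    _ = (R * A * B) * Y * S * Z * A * B := by rw [c1, c2]; noncomm_ring
    _ = B * A * (R * Y * S * Z) * A * B := by rw [y1]; noncomm_ring
    _ = B * (A * Z) * S * Y * (R * A * B) := by rw [hX]; noncomm_ring
    _ = B * Z * A * S * (Y * B) * A * R := by rw [c2, y1]; noncomm_ring
    _ = B * Z * (A * S * B) * Y * A * R := by rw [c1]; noncomm_ring
    _ = B * Z * B * S * (A * Y * A) * R := by rw [y2]; noncomm_ring

theorem leg1_auxDiag (d : Fin n → ℂ) :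
    leg1 (auxDiag L d) = Matrix.diagonal fun p => d p.1 • (1 : Op n L) := by
  refine Matrix.ext fun p q => ?_
  by_cases h : p.2 = q.2 <;> by_cases h' : p.1 = q.1 <;>
    simp [leg1, auxDiag, Matrix.diagonal_apply, h, h', Prod.ext_iff]

theorem leg2_auxDiag (d : Fin n → ℂ) :
    leg2 (auxDiag L d) = Matrix.diagonal fun p => d p.2 • (1 : Op n L) := by
  refine Matrix.ext fun p q => ?_
  by_cases h : p.2 = q.2 <;> by_cases h' : p.1 = q.1 <;>
    simp [leg2, auxDiag, Matrix.diagonal_apply, h, h', Prod.ext_iff]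

theorem reflection_kMinus (l : ℕ) (xi : ℂ) :
    Reflection fun u => (auxDiag L fun j => kMinus l xi j u : AuxOp n L) := by
  intro u v
  rw [rTwo_eq, rTwo_eq]
  refine alg_smul_refl _ _ (alg_refl (K' := leg2 (auxDiag L fun j => kMinus l xi j u))
    (J := leg1 (auxDiag L fun j => kMinus l xi j v))
    (permTwo_leg1 _) (permTwo_leg2 _) permTwo_sq ?_ ?_ ?_)
  · simp only [leg1_auxDiag, leg2_auxDiag, Matrix.diagonal_mul_diagonal, smul_mul_smul_comm,
      mul_comm]
  · simp only [leg2_auxDiag, Matrix.diagonal_mul_diagonal, smul_mul_smul_comm, mul_comm]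
  · simp only [leg1_auxDiag, leg2_auxDiag, Matrix.diagonal_mul_diagonal, smul_mul_smul_comm,
      Matrix.diagonal_sub, mul_one]
    refine Matrix.ext fun p q => ?_
    by_cases h : p = q
    · subst h
      simp only [Matrix.add_apply, Matrix.smul_apply, Matrix.diagonal_apply_eq, ← sub_smul,
        smul_smul, ← add_smul, Matrix.zero_apply]
      convert zero_smul ℂ (1 : Op n L)
      unfold kMinus
      split_ifs <;> ring
    · simp [Matrix.diagonal_apply_ne _ h]

theorem pseudovacuum_one (z : Fin n) (hz : (z : ℕ) = 0) :
    pseudovacuum n L 1 = Pi.single (fun _ => z) 1 := by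
  funext x
  have : (∀ i, (x i : ℕ) + 1 = 1) ↔ x = fun _ => z := by
    simp [funext_iff, Fin.ext_iff, hz]
  simp only [pseudovacuum, this, Pi.single_apply]

theorem permAux_vac_ne (k : Fin L) (a b : Fin n) (ha : (a : ℕ) ≠ 0) :
    (permAux k a b : Op n L) *ᵥ pseudovacuum n L 1 = 0 := by
  rw [pseudovacuum_one ⟨0, by omega⟩ rfl, Matrix.mulVec_single_one]
  funext x
  have : a ≠ ⟨0, by omega⟩ := fun h => ha (by rw [h])
  simp [permAux, siteOp_apply, this]

theorem permAux_vac (k : Fin L) (z : Fin n) (hz : (z : ℕ) = 0) :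
    (permAux k z z : Op n L) *ᵥ pseudovacuum n L 1 = pseudovacuum n L 1 := by
  rw [pseudovacuum_one z hz, Matrix.mulVec_single_one]
  funext x
  simp only [permAux, Matrix.col_apply, Matrix.of_apply, siteOp_apply, Matrix.single_apply,
    Matrix.one_apply, Pi.single_apply]
  rw [Finset.prod_ite_zero]
  by_cases h : x = fun _ => z
  · simp [h]
  · rw [if_neg h]
    by_cases hk : z = x k
    · rw [if_neg (c := ∀ i ∈ _, _)]
      · simp
      · intro h'
        apply h; funext j
        by_cases hj : j = k
        · subst hj; exact hk.symm
        · exact h' j (by simp [hj])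
    · simp [hk]

theorem rAux_apply (k : Fin L) (u : ℂ) (a b : Fin n) : (rAux k u : AuxOp n L) a b =
    (u + Complex.I)⁻¹ • (u • (if a = b then 1 else 0) + Complex.I • permAux k a b) := by
  rw [rAux_eq]; simp [Matrix.one_apply]

theorem rAux_vac_ne (k : Fin L) (u : ℂ) (a b : Fin n) (ha : (a : ℕ) ≠ 0) :
    (rAux k u a b : Op n L) *ᵥ pseudovacuum n L 1 =
      ((u + Complex.I)⁻¹ * (if a = b then u else 0)) • pseudovacuum n L 1 := by
  rw [rAux_apply]
  simp only [Matrix.smul_mulVec, Matrix.add_mulVec, permAux_vac_ne k a b ha, smul_zero, add_zero]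
  split_ifs
  · rw [Matrix.one_mulVec, smul_smul]
  · simp

theorem rAux_vac_zero (k : Fin L) (u : ℂ) (z : Fin n) (hz : (z : ℕ) = 0) :
    (rAux k u z z : Op n L) *ᵥ pseudovacuum n L 1 =
      ((u + Complex.I)⁻¹ * (u + Complex.I)) • pseudovacuum n L 1 := by
  rw [rAux_apply]
  simp only [Matrix.smul_mulVec, Matrix.add_mulVec, permAux_vac k z hz, if_true,
    Matrix.one_mulVec]
  module

theorem rAux_vac_pair (k : Fin L) (u : ℂ) (z j m : Fin n) (hz : (z : ℕ) = 0)
    (hj : (j : ℕ) ≠ 0) (hjm : j ≠ m) :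
    (rAux k u j z * rAux k u z m : Op n L) *ᵥ pseudovacuum n L 1 = 0 := by
  have hjz : j ≠ z := fun h => hj (h ▸ hz)
  rw [rAux_apply, rAux_apply]
  simp only [if_neg hjz, smul_zero, zero_add, smul_mul_assoc, mul_smul_comm, mul_add,
    permAux_mul, if_neg hjm, add_zero, Matrix.smul_mulVec]
  by_cases h : z = m
  · simp [h, permAux_vac_ne k j _ hj]
  · simp [h]

theorem rAux_vac_pair' (k : Fin L) (u : ℂ) (z j : Fin n) (hz : (z : ℕ) = 0)
    (hj : (j : ℕ) ≠ 0) : ∃ c : ℂ,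
    (rAux k u j z * rAux k u z j : Op n L) *ᵥ pseudovacuum n L 1 = c • pseudovacuum n L 1 := by
  have hjz : j ≠ z := fun h => hj (h ▸ hz)
  rw [rAux_apply, rAux_apply]
  simp only [if_neg hjz, if_neg hjz.symm, smul_zero, zero_add, smul_mul_assoc, mul_smul_comm,
    permAux_mul, if_true, Matrix.smul_mulVec, permAux_vac k z hz, smul_smul]
  exact ⟨_, rfl⟩

/-- `pseudovacuum n L 1` is a highest-weight vector of `X`. -/
def VacProp (X : AuxOp n L) : Prop :=
  (∀ j k : Fin n, (j : ℕ) ≠ 0 → j ≠ k → X j k *ᵥ pseudovacuum n L 1 = 0) ∧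
  ∀ j, ∃ d : ℂ, X j j *ᵥ pseudovacuum n L 1 = d • pseudovacuum n L 1

theorem dress_apply_vac {X : AuxOp n L} (k : Fin L) (u : ℂ)
    (hc : ∀ a b c d, Commute (X a b) ((rAux k u : AuxOp n L) c d)) (j m : Fin n) :
    (rAux k u * X * rAux k u : AuxOp n L) j m *ᵥ pseudovacuum n L 1 =
      ∑ b, ∑ a, (rAux k u j a * rAux k u b m * X a b) *ᵥ pseudovacuum n L 1 := by
  simp only [Matrix.mul_apply, Finset.sum_mul, Matrix.sum_mulVec]
  refine Finset.sum_congr rfl fun b _ => Finset.sum_congr rfl fun a _ => ?_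
  rw [mul_assoc, (hc a b b m).eq, ← mul_assoc]

theorem dress_term {X : AuxOp n L} (hX : VacProp X) (k : Fin L) (u : ℂ)
    (hc : ∀ a b c d, Commute (X a b) ((rAux k u : AuxOp n L) c d)) (j m a b : Fin n)
    (h : (j : ℕ) ≠ 0 ∨ j = m) : ∃ c : ℂ, (j ≠ m → c = 0) ∧
      (rAux k u j a * rAux k u b m * X a b) *ᵥ pseudovacuum n L 1 =
        c • pseudovacuum n L 1 := by
  have hb : (b : ℕ) ≠ 0 → ∀ Y : Op n L, (Y * rAux k u b m) *ᵥ pseudovacuum n L 1 =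
      ((u + Complex.I)⁻¹ * (if b = m then u else 0)) • (Y *ᵥ pseudovacuum n L 1) := by
    intro hb Y
    rw [← Matrix.mulVec_mulVec, rAux_vac_ne k u b m hb, Matrix.mulVec_smul]
  by_cases hab : a = b
  · subst hab
    obtain ⟨d, hd⟩ := hX.2 a
    have key : ∃ c : ℂ, (j ≠ m → c = 0) ∧ (rAux k u j a * rAux k u a m : Op n L) *ᵥ
        pseudovacuum n L 1 = c • pseudovacuum n L 1 := by
      by_cases ha : (a : ℕ) = 0
      · by_cases hj : (j : ℕ) = 0
        · have hjm : j = m := by tauto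
          have hja : j = a := Fin.ext (hj.trans ha.symm)
          subst hjm; subst hja
          rw [← Matrix.mulVec_mulVec, rAux_vac_zero k u j hj, Matrix.mulVec_smul,
            rAux_vac_zero k u j hj, smul_smul]
          exact ⟨_, fun h => absurd rfl h, rfl⟩
        · by_cases hjm : j = m
          · subst hjm
            obtain ⟨c, hc⟩ := rAux_vac_pair' k u a j ha hj
            exact ⟨c, fun h => absurd rfl h, hc⟩
          · exact ⟨0, fun _ => rfl, by rw [rAux_vac_pair k u a j m ha hj hjm, zero_smul]⟩
      · rw [hb ha]
        by_cases ham : a = m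
        · subst ham
          by_cases hj : (j : ℕ) = 0
          · have hja : j = a := by tauto
            exact absurd (hja ▸ hj) ha
          · rw [rAux_vac_ne k u j a hj, smul_smul]
            refine ⟨_, fun hja => ?_, rfl⟩
            simp [hja]
        · exact ⟨0, fun _ => rfl, by simp [ham]⟩
    obtain ⟨c, hc0, hc⟩ := key
    refine ⟨d * c, fun h => by rw [hc0 h, mul_zero], ?_⟩
    rw [← Matrix.mulVec_mulVec, hd, Matrix.mulVec_smul, hc, smul_smul]
  · refine ⟨0, fun _ => rfl, ?_⟩
    rw [zero_smul]
    by_cases ha : (a : ℕ) = 0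
    · have hb0 : (b : ℕ) ≠ 0 := fun h' => hab (Fin.ext (ha.trans h'.symm))
      have comm : rAux k u j a * rAux k u b m * X a b = X a b * (rAux k u j a * rAux k u b m) :=
        ((hc a b j a).mul_right (hc a b b m)).eq.symm
      rw [comm, ← Matrix.mulVec_mulVec, hb hb0]
      by_cases hbm : b = m
      · subst hbm
        have hj : (j : ℕ) ≠ 0 := by
          rcases h with h | h
          · exact h
          · exact h ▸ hb0
        have hja : j ≠ a := fun h' => hj (h' ▸ ha)
        rw [rAux_vac_ne k u j a hj]
        simp [hja]
      · simp [hbm]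
    · rw [← Matrix.mulVec_mulVec, hX.1 a b ha hab, Matrix.mulVec_zero]

theorem VacProp.dress {X : AuxOp n L} (hX : VacProp X) (k : Fin L) (u : ℂ)
    (hc : ∀ a b c d, Commute (X a b) ((rAux k u : AuxOp n L) c d)) :
    VacProp (rAux k u * X * rAux k u) := by
  constructor
  · intro j m hj hjm
    rw [dress_apply_vac k u hc]
    refine Finset.sum_eq_zero fun b _ => Finset.sum_eq_zero fun a _ => ?_
    obtain ⟨c, h0, h1⟩ := dress_term hX k u hc j m a b (Or.inl hj)
    rw [h1, h0 hjm, zero_smul]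
  · intro j
    choose c _ h1 using fun b a => dress_term hX k u hc j j a b (Or.inr rfl)
    refine ⟨∑ b, ∑ a, c b a, ?_⟩
    rw [dress_apply_vac k u hc]
    simp only [h1, Finset.sum_smul]

theorem VacProp.diag (d : Fin n → ℂ) : VacProp (auxDiag L d) := by
  constructor
  · intro j k _ h; simp [auxDiag, h]
  · intro j; exact ⟨d j, by simp [auxDiag, Matrix.smul_mulVec]⟩

/-- All matrix entries depend meromorphically on the parameter. -/
def MeroProp (X : ℂ → AuxOp n L) : Prop := ∀ j k x y, Meromorphic fun u => X u j k x y

theorem MeroProp.mul {X Y : ℂ → AuxOp n L} (hX : MeroProp X) (hY : MeroProp Y) :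
    MeroProp fun u => X u * Y u := by
  intro j k x y
  simp only [Matrix.mul_apply, Matrix.sum_apply]
  intro p
  refine MeromorphicAt.fun_sum fun a _ => MeromorphicAt.fun_sum fun z _ => ?_
  exact (hX j a x z p).mul (hY a k z y p)

theorem meroProp_rAux (k : Fin L) : MeroProp fun u => (rAux k u : AuxOp n L) := by
  intro a b x y p
  simp only [rAux_apply, Matrix.smul_apply, Matrix.add_apply, smul_eq_mul]
  fun_prop

theorem meroProp_kMinus (l : ℕ) (xi : ℂ) :
    MeroProp fun u => (auxDiag L fun j => kMinus l xi j u : AuxOp n L) := by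
  intro a b x y p
  by_cases h : a = b
  · subst h
    by_cases h' : (a : ℕ) < l <;>
    · simp only [auxDiag, Matrix.diagonal_apply_eq, Matrix.smul_apply, smul_eq_mul, kMinus, h',
        if_true, if_false]
      fun_prop
  · simp only [auxDiag, Matrix.diagonal_apply_ne _ h, Matrix.zero_apply]
    fun_prop

/-- The double-row monodromy matrix built from the sites in a list. -/
noncomputable def rowOf (b : BoundaryData n) (ks : List (Fin L)) (u : ℂ) : AuxOp n L :=
  (ks.map fun k => rAux k u).reverse.prod * auxDiag L (fun j => kMinus b.l b.xiMinus j u) *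
    (ks.map fun k => rAux' k u).prod

theorem doubleRow_eq (b : BoundaryData n) : doubleRow L b = rowOf b (List.finRange L) := by
  funext u
  simp only [doubleRow, rowOf, monodromy, monodromyHat, List.ofFn_eq_map]

theorem rowOf_append (b : BoundaryData n) (ks : List (Fin L)) (k : Fin L) :
    rowOf b (ks ++ [k]) = fun u => rAux k u * rowOf b ks u * rAux k u := by
  funext u
  simp [rowOf, rAux'_eq, mul_assoc]

theorem rowOf_props (b : BoundaryData n) (ks : List (Fin L)) : ks.Nodup →
    Reflection (rowOf b ks) ∧ MeroProp (rowOf b ks) ∧ (∀ u, VacProp (rowOf b ks u)) ∧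
    ∀ k ∉ ks, ∀ u v a c d e, Commute (rowOf b ks u a c) ((rAux k v : AuxOp n L) d e) := by
  induction ks using List.reverseRecOn with
  | nil =>
    intro _
    have h : rowOf b ([] : List (Fin L)) =
        fun u => auxDiag L fun j => kMinus b.l b.xiMinus j u := by
      funext u; simp [rowOf]
    rw [h]
    refine ⟨reflection_kMinus _ _, meroProp_kMinus _ _, fun u => VacProp.diag _, ?_⟩
    intro k _ u v a c d e
    by_cases hac : a = c
    · subst hac
      simp only [auxDiag, Matrix.diagonal_apply_eq]
      exact (Commute.one_left _).smul_left _
    · simp only [auxDiag, Matrix.diagonal_apply_ne _ hac]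
      exact Commute.zero_left _
  | append_singleton ks k ih =>
    intro hnd
    rw [List.nodup_append] at hnd
    obtain ⟨h1, h2, h3, h4⟩ := ih hnd.1
    have hk : k ∉ ks := fun h => hnd.2.2 k h k (by simp) rfl
    rw [rowOf_append]
    refine ⟨h1.dress k fun u v => h4 k hk u v, ((meroProp_rAux k).mul h2).mul (meroProp_rAux k),
      fun u => (h3 u).dress k u (h4 k hk u u), ?_⟩
    intro k' hk' u v a c d e
    simp only [List.mem_append, List.mem_singleton, not_or] at hk'
    have hr : ∀ p q, Commute ((rAux k u : AuxOp n L) p q) ((rAux k' v : AuxOp n L) d e) :=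
      fun p q => siteOp_comm (Ne.symm hk'.2) _ _
    simp only [Matrix.mul_apply]
    refine Commute.sum_left _ _ _ fun p _ => (Commute.mul_left ?_ (hr _ _))
    exact Commute.sum_left _ _ _ fun q _ => (hr _ _).mul_left (h4 k' hk'.1 u v _ _ _ _)

end proofs

/-- The usual implementation: the transfer matrix `t_{(l)}(u, ξ∓)` with the pseudovacuum
`ω_(1)` and the double-row monodromy matrix `T₀(u) K⁻₀(u) T̂₀(u)`. The vacuum eigenvalues are
read off as matrix elements at `ω_(1)`. -/
noncomputable def standardAnsatz {n : ℕ} (L : ℕ) (b : BoundaryData n) :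
    BetheAnsatz (transfer L b) (pseudovacuum n L 1) where
  l := b.l
  one_le := b.one_le
  lt := b.lt
  xiPlus := b.xiPlus
  mono := doubleRow L b
  meromorphic := by
    rw [doubleRow_eq]; exact (rowOf_props b _ (List.nodup_finRange L)).2.1
  reflection := by
    rw [doubleRow_eq]; exact (rowOf_props b _ (List.nodup_finRange L)).1
  trace_eq := fun _ => rfl
  vac := fun j u => doubleRow L b u j j
    (fun _ => ⟨0, b.one_le.trans b.lt.le⟩) (fun _ => ⟨0, b.one_le.trans b.lt.le⟩)
  vacuum_ne := by
    rw [pseudovacuum_one ⟨0, b.one_le.trans b.lt.le⟩ rfl]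
    intro h
    simpa using congrFun h fun _ => ⟨0, b.one_le.trans b.lt.le⟩
  vacuum_lower := by
    intro u j k h
    rw [doubleRow_eq]
    refine ((rowOf_props b _ (List.nodup_finRange L)).2.2.1 u).1 j k ?_ h.ne'
    have := Fin.lt_def.1 h
    omega
  vacuum_diag := by
    intro u j
    obtain ⟨d, hd⟩ := ((rowOf_props b _ (List.nodup_finRange L)).2.2.1 u).2 j
    rw [← doubleRow_eq] at hd
    rw [hd]
    congr 1
    rw [pseudovacuum_one ⟨0, b.one_le.trans b.lt.le⟩ rfl, Matrix.mulVec_single_one] at hd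
    simpa using (congrFun hd fun _ => ⟨0, b.one_le.trans b.lt.le⟩).symm


end OpenChain

namespace OpenChain

variable {n L : ℕ}

/-! The Bethe Ansatz equations of an implementation see only the parameters of `K⁺` and the vacuum
eigenvalues, not the operators themselves. Let `W` be unitary and conjugate every entry of the
matrix `𝒯(u)` by it. Conjugation is a unital algebra homomorphism of the quantum operators, while
`R` and `K⁺` have scalar entries there, so the reflection equation and the trace formula survive
(`reflection_map`, `map_trace_auxDiag_mul`). Since `W X W† (W Ω) = W (X Ω)`, the highest-weight
conditions pass from `Ω` to `W Ω` with unchanged eigenvalues (`conjHom_mulVec`). Hence an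
implementation for `(t, Ω)` becomes one for `(W t W†, W Ω)` with literally the same equations
(`BetheAnsatz.conj`), and `W†` undoes the passage (`isBAE_conj_iff`).

The theorem is the case `W = U (g b)`: because `g` is an involution, this operator carries the
transfer matrix of `g b` to that of `b`, and `ω` to `ω'`. No explicit form of the equations is
needed. -/

/-! ### Algebra homomorphisms applied entrywise in the auxiliary space -/

theorem rTwo_map (φ : Op n L →ₐ[ℂ] Op n L) (u : ℂ) : (rTwo n L u).map φ = rTwo n L u := by
  refine Matrix.ext fun p q => ?_
  simp only [rTwo, Matrix.map_apply, map_smul, map_one]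

theorem leg1_map (φ : Op n L →ₐ[ℂ] Op n L) (A : AuxOp n L) :
    (leg1 A).map φ = leg1 (A.map φ) := by
  refine Matrix.ext fun p q => ?_
  simp only [leg1, Matrix.map_apply, Matrix.of_apply]
  split_ifs <;> simp

theorem leg2_map (φ : Op n L →ₐ[ℂ] Op n L) (A : AuxOp n L) :
    (leg2 A).map φ = leg2 (A.map φ) := by
  refine Matrix.ext fun p q => ?_
  simp only [leg2, Matrix.map_apply, Matrix.of_apply]
  split_ifs <;> simp

/-- The trace is a linear combination, with scalar coefficients `d j`, of the diagonal entries of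
`A`, so linearity of `φ` suffices. Used with `d` the diagonal of `K⁺`, it gives the trace formula
for the transformed monodromy matrix. -/
theorem map_trace_auxDiag_mul (φ : Op n L →ₐ[ℂ] Op n L) (d : Fin n → ℂ) (A : AuxOp n L) :
    φ (Matrix.trace (auxDiag L d * A)) = Matrix.trace (auxDiag L d * A.map φ) := by
  simp [Matrix.trace, auxDiag, Matrix.diagonal_mul]

/-- Algebra endomorphisms acting on the quantum space preserve the reflection equation. -/
theorem reflection_map (φ : Op n L →ₐ[ℂ] Op n L) {A B : AuxOp n L} {u v : ℂ}
    (h : rTwo n L (u - v) * leg1 A * rTwo n L (u + v) * leg2 B =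
      leg2 B * rTwo n L (u + v) * leg1 A * rTwo n L (u - v)) :
    rTwo n L (u - v) * leg1 (A.map φ) * rTwo n L (u + v) * leg2 (B.map φ) =
      leg2 (B.map φ) * rTwo n L (u + v) * leg1 (A.map φ) * rTwo n L (u - v) := by
  -- Entrywise application of `φ` is multiplicative on matrices over the operator algebra; the `R`
  -- factors stay fixed because their entries are multiples of the identity.
  simpa only [Matrix.map_mul, rTwo_map, leg1_map, leg2_map] using
    congrArg (fun X => X.map φ) h

/-! ### Conjugation by a unitary operator -/

/-- Conjugation `X ↦ W X W†` by a unitary operator. -/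
noncomputable def conjHom (W : Matrix.unitaryGroup (Fin L → Fin n) ℂ) : Op n L →ₐ[ℂ] Op n L :=
  (Unitary.conjStarAlgAut ℂ (Op n L) W).toAlgEquiv.toAlgHom

theorem conjHom_apply (W : Matrix.unitaryGroup (Fin L → Fin n) ℂ) (X : Op n L) :
    conjHom W X = (W : Op n L) * X * (W : Op n L)ᴴ :=
  rfl

/-- The inner `W†` cancels against the `W` in front of `Ω`. Annihilation and eigenvalue relations on
`Ω` thereby become the same relations on `W Ω`. -/
theorem conjHom_mulVec (W : Matrix.unitaryGroup (Fin L → Fin n) ℂ) (X : Op n L)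
    (Ω : State n L) : conjHom W X *ᵥ ((W : Op n L) *ᵥ Ω) = (W : Op n L) *ᵥ (X *ᵥ Ω) := by
  have h : (W : Op n L)ᴴ * (W : Op n L) = 1 := Unitary.coe_star_mul_self W
  rw [conjHom_apply, Matrix.mulVec_mulVec, Matrix.mulVec_mulVec, mul_assoc, h, mul_one]

/-! ### Transport of implementations and of their Bethe equations -/

/-- An implementation for `(t, Ω)` conjugated by a unitary `W` is an implementation for
`(W t W†, W Ω)`, with the same `K⁺` and the same vacuum eigenvalues. -/
noncomputable def BetheAnsatz.conj {t t' : ℂ → Op n L} {Ω Ω' : State n L} (A : BetheAnsatz t Ω)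
    (W : Matrix.unitaryGroup (Fin L → Fin n) ℂ)
    (ht : ∀ u, (W : Op n L) * t u * (W : Op n L)ᴴ = t' u) (hΩ : (W : Op n L) *ᵥ Ω = Ω') :
    BetheAnsatz t' Ω' where
  l := A.l
  one_le := A.one_le
  lt := A.lt
  xiPlus := A.xiPlus
  mono := fun u => (A.mono u).map (conjHom W)
  meromorphic := by
    intro j k x y p
    simp only [Matrix.map_apply, conjHom_apply, Matrix.mul_apply]
    -- Each entry of `W X(u) W†` is a finite linear combination, with coefficients independent of
    -- `u`, of entries of `X(u)`.
    refine MeromorphicAt.fun_sum fun a _ => MeromorphicAt.mul ?_ (MeromorphicAt.const _ _)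
    exact MeromorphicAt.fun_sum fun c _ =>
      MeromorphicAt.mul (MeromorphicAt.const _ _) (A.meromorphic j k c a p)
  reflection := fun u v => reflection_map _ (A.reflection u v)
  trace_eq := by
    intro u
    rw [← map_trace_auxDiag_mul, ← A.trace_eq, conjHom_apply, ht]
  vac := A.vac
  vacuum_ne := by
    -- If `W Ω` were zero, then `Ω = W† W Ω` would vanish as well.
    rintro rfl
    have h : (W : Op n L)ᴴ * (W : Op n L) = 1 := Unitary.coe_star_mul_self W
    apply A.vacuum_ne
    rw [← Matrix.one_mulVec Ω, ← h, ← Matrix.mulVec_mulVec, hΩ, Matrix.mulVec_zero]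
  vacuum_lower := by
    intro u j k hjk
    rw [← hΩ, Matrix.map_apply, conjHom_mulVec, A.vacuum_lower u j k hjk, Matrix.mulVec_zero]
  vacuum_diag := by
    intro u j
    rw [← hΩ, Matrix.map_apply, conjHom_mulVec, A.vacuum_diag u j, Matrix.mulVec_smul]

/-- Systems of Bethe Ansatz equations are transported by unitary equivalences. -/
theorem IsBAE.conj {t t' : ℂ → Op n L} {Ω Ω' : State n L}
    {E : (M : Fin (n - 1) → ℕ) → Roots n M → Prop} (h : IsBAE t Ω E)
    (W : Matrix.unitaryGroup (Fin L → Fin n) ℂ)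
    (ht : ∀ u, (W : Op n L) * t u * (W : Op n L)ᴴ = t' u) (hΩ : (W : Op n L) *ᵥ Ω = Ω') :
    IsBAE t' Ω' E :=
  -- `hA` is reused unchanged: `SolvesBAE` depends on the implementation only through `l`, `xiPlus`
  -- and `vac`, which `conj` copies, so the two conditions agree definitionally.
  h.elim fun A hA => ⟨A.conj W ht hΩ, hA⟩

/-- Transport is reversible: the hypotheses for `W` turn into those for `W⁻¹` with the two pairs
exchanged. -/
theorem isBAE_conj_iff {t t' : ℂ → Op n L} {Ω Ω' : State n L}
    (E : (M : Fin (n - 1) → ℕ) → Roots n M → Prop)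
    (W : Matrix.unitaryGroup (Fin L → Fin n) ℂ)
    (ht : ∀ u, (W : Op n L) * t u * (W : Op n L)ᴴ = t' u) (hΩ : (W : Op n L) *ᵥ Ω = Ω') :
    IsBAE t' Ω' E ↔ IsBAE t Ω E := by
  have hW : (W : Op n L)ᴴ * (W : Op n L) = 1 := Unitary.coe_star_mul_self W
  refine ⟨fun h => h.conj W⁻¹ (fun u => ?_) ?_, fun h => h.conj W ht hΩ⟩
  -- In the unitary group the inverse is by definition the adjoint, so `change` can replace `W⁻¹` by
  -- `W†`.
  · change (W : Op n L)ᴴ * t' u * ((W : Op n L)ᴴ)ᴴ = t u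
    rw [← ht, Matrix.conjTranspose_conjTranspose, mul_assoc, mul_assoc, hW, mul_one,
      ← mul_assoc, hW, one_mul]
  · change (W : Op n L)ᴴ *ᵥ Ω' = Ω
    rw [← hΩ, Matrix.mulVec_mulVec, hW, Matrix.one_mulVec]

end OpenChain

/-! ### The lemma for boundary data related by an involution -/

theorem mainTheorem1 (n L : ℕ)
    (D : Set (OpenChain.BoundaryData n))
    (g : OpenChain.BoundaryData n → OpenChain.BoundaryData n)
    (hgD : ∀ b ∈ D, g b ∈ D) (hg : ∀ b ∈ D, g (g b) = b)
    (U : OpenChain.BoundaryData n → Matrix.unitaryGroup (Fin L → Fin n) ℂ)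
    (ω ω' : OpenChain.State n L)
    (hU : ∀ b ∈ D, ∀ u : ℂ,
      (U b : OpenChain.Op n L) * OpenChain.transfer L b u * (U b : OpenChain.Op n L)ᴴ =
        OpenChain.transfer L (g b) u)
    (hω : ∀ b ∈ D, (U b : OpenChain.Op n L) *ᵥ ω = ω') :
    ∀ b ∈ D,
      (∀ E : (M : Fin (n - 1) → ℕ) → OpenChain.Roots n M → Prop,
        OpenChain.IsBAE (OpenChain.transfer L b) ω' E ↔
          OpenChain.IsBAE (OpenChain.transfer L (g b)) ω E) ∧
      (ω = OpenChain.pseudovacuum n L 1 →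
        OpenChain.IsBAE (OpenChain.transfer L b) ω'
          fun _ v => (OpenChain.standardAnsatz L (g b)).SolvesBAE v) := by
  intro b hb
  have key (E : (M : Fin (n - 1) → ℕ) → OpenChain.Roots n M → Prop) :
      OpenChain.IsBAE (OpenChain.transfer L b) ω' E ↔
        OpenChain.IsBAE (OpenChain.transfer L (g b)) ω E :=
    -- The operator attached to `g b`, not to `b`, is the right one: `U b` would relate `b` with `ω`
    -- to `g b` with `ω'`. Starting from `g b` and using `g (g b) = b` puts `ω'` on the side of `b`.
    OpenChain.isBAE_conj_iff E (U (g b))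
      (fun u => by rw [hU _ (hgD b hb), hg b hb]) (hω _ (hgD b hb))
  refine ⟨key, ?_⟩
  rintro rfl
  -- With `ω = ω_(1)` the standard implementation for `g b` exists, and its equations are trivially
  -- a system for `g b` with `ω`; `key` moves them to `b` with `ω'`.
  exact (key _).2 ⟨OpenChain.standardAnsatz L (g b), fun _ _ => Iff.rfl⟩
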